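/- Let $K$ be an algebraically closed field of characteristic $0$, let $m \ge 1$ and $n$ be integers ($n \ge 0$), and let $f : \mathbb{P}^n \to \mathbb{P}^n$ be a nonlinear endomorphism over $K$, that is, a morphism given by $n+1$ homogeneous forms of one common degree $d \ge 2$ in $n+1$ variables over $K$ having no common zero in $\mathbb{P}^n$. Let $\mathcal{F}^n_m$ be the projective space of nonzero degree-$m$ homogeneous forms in $n+1$ variables over $K$ up to scaling, and for $\Phi \in \mathcal{F}^n_m$ let $V(\Phi) \subseteq \mathbb{P}^n$ be its vanishing locus. Call a closed set $H = V(\Phi)$ improper under an endomorphism $g$ of $\mathbb{P}^n$ if for every irreducible component $Z$ of $H$ there exist integers $0 \le i_0 < i_1 < \dots < i_n$ such that $$g^{i_0}(Z) \cap g^{i_1}(Z) \cap \dots \cap g^{i_n}(Z) \ne \varnothing,$$ where $g^i$ is the $i$-fold iterate; and call $H$ dynamically improper under $f$ if $H$ is improper under the iterate $f^r$ for every integer $r > 0$. Then the set $$\{\Phi \in \mathcal{F}^n_m : V(\Phi) \text{ is dynamically improper under } f\}$$ is Zariski dense in $\mathcal{F}^n_m$. -/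

import Mathlib

open scoped LinearAlgebra.Projectivization

namespace DynImproper

/-- The common zero locus in `ℙ K V` of a set of polynomials in the linear forms on `V`, i.e. of
elements of `K[V*]`. It is only used for homogeneous polynomials, for which vanishing at a point
does not depend on the representative vector. -/
def projZeroLocus {K V : Type*} [Field K] [AddCommGroup V] [Module K V]
    (S : Set (MvPolynomial (Module.Dual K V) K)) : Set (ℙ K V) :=
  {x | ∀ p ∈ S, MvPolynomial.eval (fun φ : Module.Dual K V => φ x.rep) p = 0}

/-- A subset of `ℙ K V` is Zariski closed if it is the zero locus of a set of homogeneous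
polynomials (of possibly different degrees). -/
def IsZariskiClosed {K V : Type*} [Field K] [AddCommGroup V] [Module K V]
    (Z : Set (ℙ K V)) : Prop :=
  ∃ S : Set (MvPolynomial (Module.Dual K V) K),
    (∀ p ∈ S, ∃ k : ℕ, p.IsHomogeneous k) ∧ Z = projZeroLocus S

/-- The Zariski topology on the projective space of a vector space. -/
instance zariskiTopology (K V : Type*) [Field K] [AddCommGroup V] [Module K V] :
    TopologicalSpace (ℙ K V) :=
  TopologicalSpace.ofClosed {Z | IsZariskiClosed Z}
    (by
      refine ⟨{1}, ?_, ?_⟩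
      · rintro p rfl
        exact ⟨0, MvPolynomial.isHomogeneous_one _ _⟩
      · ext x
        simp [projZeroLocus])
    (by
      intro A hA
      refine ⟨{p | (∃ k : ℕ, p.IsHomogeneous k) ∧ ∃ Z ∈ A, ∀ x ∈ Z,
        MvPolynomial.eval (fun φ : Module.Dual K V => φ x.rep) p = 0}, fun p hp => hp.1, ?_⟩
      ext x
      constructor
      · rintro hx p ⟨-, Z, hZ, h⟩
        exact h x (hx Z hZ)
      · intro hx Z hZ
        obtain ⟨S, hS, rfl⟩ := hA hZ
        intro p hp
        exact hx p ⟨hS p hp, _, hZ, fun y hy => hy p hp⟩)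
    (by
      rintro _ ⟨S, hS, rfl⟩ _ ⟨T, hT, rfl⟩
      refine ⟨{r | ∃ p ∈ S, ∃ q ∈ T, r = p * q}, ?_, ?_⟩
      · rintro _ ⟨p, hp, q, hq, rfl⟩
        obtain ⟨k, hk⟩ := hS p hp
        obtain ⟨l, hl⟩ := hT q hq
        exact ⟨k + l, hk.mul hl⟩
      · ext x
        constructor
        · rintro (hx | hx) _ ⟨p, hp, q, hq, rfl⟩
          · simp [hx p hp]
          · simp [hx q hq]
        · intro hx
          by_contra hcon
          simp only [Set.mem_union, not_or] at hcon
          obtain ⟨h1, h2⟩ := hcon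
          simp only [projZeroLocus, Set.mem_ofPred_eq, not_forall] at h1 h2
          obtain ⟨p, hp, hp0⟩ := h1
          obtain ⟨q, hq, hq0⟩ := h2
          have := hx _ ⟨p, hp, q, hq, rfl⟩
          rw [map_mul] at this
          exact (mul_ne_zero hp0 hq0) this)

/-- The projective `n`-space over `K`, as a set of closed points, with its Zariski topology. -/
abbrev ProjSpace (K : Type*) [Field K] (n : ℕ) : Type _ := ℙ K (Fin (n + 1) → K)

/-- The projective space of degree-`m` homogeneous forms in `n + 1` variables. -/
abbrev FormSpace (K : Type*) [Field K] (n m : ℕ) : Type _ :=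
  ℙ K (MvPolynomial.homogeneousSubmodule (Fin (n + 1)) K m)

/-- The vanishing locus `V(Φ)` of a form `Φ`, given up to scaling. -/
def vanishingLocus {K : Type*} [Field K] {n m : ℕ} (Φ : FormSpace K n m) :
    Set (ProjSpace K n) :=
  {x | MvPolynomial.eval x.rep (Φ.rep : MvPolynomial (Fin (n + 1)) K) = 0}

/-- `f` is an endomorphism of `ℙⁿ` of degree `d`: it is given by `n + 1` homogeneous forms of
degree `d` in `n + 1` variables without a common zero in projective space. -/
def IsEndomorphism {K : Type*} [Field K] {n : ℕ} (d : ℕ)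
    (f : ProjSpace K n → ProjSpace K n) : Prop :=
  ∃ F : Fin (n + 1) → MvPolynomial (Fin (n + 1)) K,
    (∀ i, (F i).IsHomogeneous d) ∧
    ∀ (v : Fin (n + 1) → K) (hv : v ≠ 0),
      ∃ hFv : (fun i => MvPolynomial.eval v (F i)) ≠ 0,
        f (Projectivization.mk K v hv) =
          Projectivization.mk K (fun i => MvPolynomial.eval v (F i)) hFv

/-- `Z` is an irreducible component of the subset `H` of a topological space: a maximal
irreducible subset of `H`. -/
def IsIrreducibleComponentOf {X : Type*} [TopologicalSpace X] (Z H : Set X) : Prop :=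
  Maximal (fun W : Set X => IsIrreducible W ∧ W ⊆ H) Z

/-- `H` is improper under `f`: for every irreducible component `Z` of `H` there are
`0 ≤ i₀ < … < iₙ` such that `f^{i₀}(Z), …, f^{iₙ}(Z)` have a common point. -/
def IsImproper {K : Type*} [Field K] {n : ℕ} (f : ProjSpace K n → ProjSpace K n)
    (H : Set (ProjSpace K n)) : Prop :=
  ∀ Z : Set (ProjSpace K n), IsIrreducibleComponentOf Z H →
    ∃ i : Fin (n + 1) → ℕ, StrictMono i ∧ (⋂ j, f^[i j] '' Z).Nonempty

/-- `H` is dynamically improper under `f`: it is improper under every iterate `f^r`, `r > 0`. -/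
def IsDynamicallyImproper {K : Type*} [Field K] {n : ℕ} (f : ProjSpace K n → ProjSpace K n)
    (H : Set (ProjSpace K n)) : Prop :=
  ∀ r : ℕ, 0 < r → IsImproper f^[r] H

end DynImproper

/-! If a component `Z` contains a preperiodic point, suitable iterates of `f^[r]` all send that
point to one place, so any number of images of `Z` meet. It therefore suffices that forms whose
irreducible factors each vanish at a preperiodic point are dense.

Preperiodic points are plentiful (`infinite_ratio_preperiodic`). The forms `F` defining `f` have a
model over a ring `O`, integrally closed in `K`, with residue fields algebraic over finite fields
(`exists_integral_model`). Every vector over such a residue field is preperiodic, so it solves `F^i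
= F^j` with `i < j`. As `F^j` has larger degree than `F^i` and no nontrivial zero, `O[X]` is
integral over the subring generated by the `F^j - F^i`, which is itself a polynomial ring, hence
normal. Going-down then lifts the solution to one over `O` (`exists_lift_of_common_zero`). The
residue field being infinite, infinitely many coordinate ratios occur.

For density, a nonempty open set of forms contains a product with the largest possible number of
factors of positive degree. Each factor can be moved within the open set until it meets one of the
infinitely many preperiodic points (`exists_deformation_through_point`), and maximality makes the
factors irreducible. -/

open scoped LinearAlgebra.Projectivization

namespace DynImproper

open MvPolynomial

/-! ### Forms of equal degree: coefficients and integrality -/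

section HomogeneousComponents

variable {σ R : Type*} [CommRing R]

/-- Multiplication by a form of degree `D` shifts homogeneous components by `D`. -/
theorem homogeneousComponent_mul_of_isHomogeneous {D : ℕ} (c : MvPolynomial σ R)
    {h : MvPolynomial σ R} (hh : h.IsHomogeneous D) (k : ℕ) :
    homogeneousComponent k (c * h) =
      if D ≤ k then homogeneousComponent (k - D) c * h else 0 := by
  let _ := MvPolynomial.gradedAlgebra (σ := σ) (R := R)
  have key := DirectSum.coe_decompose_mul_of_right_mem (homogeneousSubmodule σ R) (a := c)
    (b := h) (i := D) k hh
  have e : ∀ (φ : MvPolynomial σ R) (i : ℕ),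
      (DirectSum.decompose (homogeneousSubmodule σ R) φ i : MvPolynomial σ R) =
        homogeneousComponent i φ := decomposition.decompose'_apply
  simpa only [e] using key

/-- A form in the ideal generated by forms of degree `D` is a combination of them with coefficients
that are forms. -/
theorem exists_isHomogeneous_coeffs_of_mem_span {ι : Type*} [Fintype ι] {D k : ℕ}
    {H : ι → MvPolynomial σ R} (hH : ∀ i, (H i).IsHomogeneous D) {p : MvPolynomial σ R}
    (hp : p.IsHomogeneous k) (hpI : p ∈ Ideal.span (Set.range H)) :
    ∃ c : ι → MvPolynomial σ R, (∀ i, c i = 0 ∨ D ≤ k ∧ (c i).IsHomogeneous (k - D)) ∧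
      p = ∑ i, c i * H i := by
  obtain ⟨c, hc⟩ := Ideal.mem_span_range_iff_exists_fun.1 hpI
  -- Degree-`k` part of the given combination. The `if` is needed because `k - D` truncates to `0`
  -- when `k < D`.
  refine ⟨fun i => if D ≤ k then homogeneousComponent (k - D) (c i) else 0, fun i => ?_, ?_⟩
  · by_cases h : D ≤ k
    · right
      simp only [h, if_true, true_and]
      exact homogeneousComponent_isHomogeneous _ _
    · left; simp [h]
  · rw [← homogeneousComponent_eq_self hp, ← hc, map_sum]
    refine Finset.sum_congr rfl fun i _ => ?_
    rw [homogeneousComponent_mul_of_isHomogeneous _ (hH i)]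
    split_ifs <;> simp

end HomogeneousComponents

section Integrality

variable {ι R : Type*} [Fintype ι] [CommRing R]

/-- If the forms `H i` of degree `D` generate an ideal whose radical contains all variables, then
the polynomial ring is integral over the subalgebra generated by perturbations of the `H i` by
terms of lower degree. -/
theorem isIntegral_adjoin_of_leadingForms {D : ℕ} {H G : ι → MvPolynomial ι R}
    (hH : ∀ i, (H i).IsHomogeneous D) (hG : ∀ i, (G i).totalDegree < D)
    (hrad : ∀ i, (X i : MvPolynomial ι R) ∈ (Ideal.span (Set.range H)).radical) :
    Algebra.IsIntegral (Algebra.adjoin R (Set.range fun i => H i - G i)) (MvPolynomial ι R) := by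
  classical
  set B := Algebra.adjoin R (Set.range fun i => H i - G i)
  choose N hN using hrad
  set b : ι →₀ ℕ := Finsupp.equivFunOnFinite.symm N
  -- `W` is spanned by the finitely many monomials dividing `X ^ b`. Any other monomial is some `∑ c
  -- j * H j`, and writing `H j = (H j - G j) + G j` reduces it to lower degree, so `W` is
  -- everything.
  set W : Submodule B (MvPolynomial ι R) :=
    Submodule.span B ((fun s => monomial s (1 : R)) '' Set.Iic b)
  have hsmul : ∀ (r : R) (p : MvPolynomial ι R), p ∈ W → C r * p ∈ W := fun r p hp => by
    have := W.smul_mem (algebraMap R B r) hp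
    rwa [Algebra.smul_def] at this
  have hpoly : ∀ (k : ℕ), (∀ s : ι →₀ ℕ, s.degree < k → monomial s (1 : R) ∈ W) →
      ∀ p : MvPolynomial ι R, p.totalDegree < k → p ∈ W := fun k hk p hp => by
    rw [p.as_sum]
    refine W.sum_mem fun s hs => ?_
    rw [← mul_one (coeff s p), ← C_mul_monomial]
    exact hsmul _ _ (hk s (lt_of_le_of_lt (le_totalDegree hs) hp))
  have hmon : ∀ (k : ℕ) (s : ι →₀ ℕ), s.degree = k → monomial s (1 : R) ∈ W := by
    intro k
    induction k using Nat.strong_induction_on with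
    | _ k ih =>
      intro s hs
      by_cases hsb : s ≤ b
      · exact Submodule.subset_span ⟨s, hsb, rfl⟩
      obtain ⟨i, hi⟩ : ∃ i, N i < s i := by
        by_contra! hcon
        exact hsb fun i => by simpa [b] using hcon i
      have hI : monomial s (1 : R) ∈ Ideal.span (Set.range H) := by
        have : monomial s (1 : R) = monomial (s - Finsupp.single i (N i)) 1 * X i ^ N i := by
          rw [X_pow_eq_monomial, monomial_mul, one_mul, tsub_add_cancel_of_le]
          simpa using hi.le
        rw [this]
        exact Ideal.mul_mem_left _ _ (hN i)
      obtain ⟨c, hc, hsum⟩ := exists_isHomogeneous_coeffs_of_mem_span hH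
        (isHomogeneous_monomial (1 : R) hs) hI
      rw [hsum]
      refine W.sum_mem fun j _ => ?_
      rcases hc j with h0 | ⟨hDk, hcj⟩
      · simp [h0]
      have hlow := hpoly k fun t ht => ih _ ht t rfl
      have hdeg := hcj.totalDegree_le
      have hGj := hG j
      -- `D` is positive, since `hG j` puts a natural number strictly below it; hence `c j` has
      -- degree below `k`.
      have h1 : c j ∈ W := hlow _ (by omega)
      have h2 : c j * G j ∈ W := hlow _ ((totalDegree_mul _ _).trans_lt (by omega))
      have h3 := W.smul_mem (⟨H j - G j, Algebra.subset_adjoin ⟨j, rfl⟩⟩ : B) h1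
      have : c j * H j = (H j - G j) * c j + c j * G j := by ring
      rw [this]
      exact W.add_mem h3 h2
  have htop : W = ⊤ := by
    refine eq_top_iff.2 fun p _ => ?_
    exact hpoly (p.totalDegree + 1) (fun s _ => hmon _ s rfl) p (Nat.lt_succ_self _)
  have : Module.Finite B (MvPolynomial ι R) := by
    rw [Module.finite_def, ← htop]
    exact Submodule.fg_span ((Set.finite_Iic b).image _)
  infer_instance

end Integrality

/-! ### Polynomials of the iterates -/

section Iterates

variable {ι R : Type*} [CommRing R]

/-- The polynomials giving the `k`-th iterate of the self-map of affine space defined by `F`. -/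
noncomputable def iterPoly (F : ι → MvPolynomial ι R) : ℕ → ι → MvPolynomial ι R
  | 0 => X
  | k + 1 => fun i => bind₁ (iterPoly F k) (F i)

/-- Evaluation along an arbitrary `ρ` lets the same polynomials serve over a ring and over its
residue field. -/
theorem eval₂_iterPoly {S : Type*} [CommRing S] (F : ι → MvPolynomial ι R) (ρ : R →+* S)
    (v : ι → S) (k : ℕ) :
    (fun i => eval₂ ρ v (iterPoly F k i)) = (fun w i => eval₂ ρ w (F i))^[k] v := by
  induction k with
  | zero => funext i; simp [iterPoly]
  | succ k ih =>
    rw [Function.iterate_succ_apply', ← ih]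
    funext i
    exact eval₂Hom_bind₁ ρ v (iterPoly F k) (F i)

theorem isHomogeneous_iterPoly {d : ℕ} {F : ι → MvPolynomial ι R}
    (hF : ∀ i, (F i).IsHomogeneous d) (k : ℕ) (i : ι) : (iterPoly F k i).IsHomogeneous (d ^ k) := by
  induction k generalizing i with
  | zero => simpa [iterPoly] using isHomogeneous_X R i
  | succ k ih =>
    rw [pow_succ]
    exact (hF i).aeval _ ih

/-- Substituting the `k`-th iterate into `X j ^ N ∈ (F)` shows that the `k`-th iterate is nilpotent
modulo the next one. -/
theorem X_mem_radical_span_iterPoly {F : ι → MvPolynomial ι R}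
    (hrad : ∀ i, (X i : MvPolynomial ι R) ∈ (Ideal.span (Set.range F)).radical) (k : ℕ) (i : ι) :
    (X i : MvPolynomial ι R) ∈ (Ideal.span (Set.range (iterPoly F k))).radical := by
  induction k generalizing i with
  | zero => exact Ideal.le_radical (Ideal.subset_span ⟨i, rfl⟩)
  | succ k ih =>
    have hle : Ideal.span (Set.range (iterPoly F k)) ≤
        (Ideal.span (Set.range (iterPoly F (k + 1)))).radical := by
      rw [Ideal.span_le]
      rintro _ ⟨j, rfl⟩
      obtain ⟨N, hN⟩ := hrad j
      refine ⟨N, ?_⟩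
      have := Ideal.mem_map_of_mem (bind₁ (iterPoly F k)) hN
      rw [Ideal.map_span, ← Set.range_comp, map_pow, bind₁_X_right] at this
      exact this
    exact Ideal.radical_le_radical_iff.2 hle (ih i)

end Iterates

/-! ### Preperiodic points: reduction to residue fields and lifting -/

/-- Polynomial rings over an integrally closed domain are integrally closed. -/
theorem isIntegrallyClosed_mvPolynomial_fin {R : Type*} [CommRing R] [IsDomain R]
    [IsIntegrallyClosed R] (n : ℕ) : IsIntegrallyClosed (MvPolynomial (Fin n) R) := by
  induction n with
  | zero => exact IsIntegrallyClosed.of_equiv (isEmptyAlgEquiv R (Fin 0)).symm.toRingEquiv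
  | succ n ih => exact IsIntegrallyClosed.of_equiv (finSuccEquiv R n).symm.toRingEquiv

/-- Let `O` be integrally closed in an algebraically closed field `K`, and let `y` be as many
polynomials over `O` as there are variables, over which the polynomial ring is integral. Then a
common zero of the reductions of the `y i` lifts to a common zero of the `y i`. -/
theorem exists_lift_of_common_zero {O K κ : Type*} [CommRing O] [IsDomain O] [Field K]
    [IsAlgClosed K] [Algebra O K] [IsIntegrallyClosedIn O K] [Field κ] (ρ : O →+* κ) {n : ℕ}
    (y : Fin n → MvPolynomial (Fin n) O)
    [Algebra.IsIntegral (Algebra.adjoin O (Set.range y)) (MvPolynomial (Fin n) O)]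
    (v : Fin n → κ) (hv : ∀ i, eval₂ ρ v (y i) = 0) :
    ∃ a : Fin n → O, (∀ i, eval a (y i) = 0) ∧ ∀ i, ρ (a i) = v i := by
  have hOinj : Function.Injective (algebraMap O K) := (isIntegrallyClosedIn_iff.1 ‹_›).1
  have hKfree : Module.IsTorsionFree O K := Module.isTorsionFree_iff_algebraMap_injective.2 hOinj
  have : IsIntegrallyClosed O := .of_isIntegrallyClosed_of_isIntegrallyClosedIn _ K
  -- `n` elements over which a domain of transcendence degree `n` is algebraic form a transcendence
  -- basis. So `B` is a polynomial ring, which supplies the normality for going-down.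
  have hy : AlgebraicIndependent O y :=
    (Algebra.IsAlgebraic.isTranscendenceBasis_of_lift_le_trdeg_of_finite O y
      (by rw [MvPolynomial.trdeg_of_isDomain]; simp)).1
  set B := Algebra.adjoin O (Set.range y)
  let e : MvPolynomial (Fin n) O ≃ₐ[O] B := hy.aevalEquiv
  have := isIntegrallyClosed_mvPolynomial_fin (R := O) n
  have : IsIntegrallyClosed B := IsIntegrallyClosed.of_equiv e.toRingEquiv
  -- `ψ` sends every `y i` to `0`; its kernel lies below `Q` because the `y i` vanish at `v`.
  let ψ : B →+* O := (eval (0 : Fin n → O)).comp e.symm.toRingEquiv.toRingHom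
  let Q : Ideal (MvPolynomial (Fin n) O) := RingHom.ker (eval₂Hom ρ v)
  have hQ : Q.IsPrime := RingHom.ker_isPrime _
  have hle : RingHom.ker ψ ≤ Q.under B := by
    intro b hb
    obtain ⟨g, rfl⟩ := e.surjective b
    have hg : eval (0 : Fin n → O) g = 0 := by
      have h : ψ (e g) = 0 := hb
      simpa [ψ] using h
    change eval₂Hom ρ v (algebraMap B _ (e g)) = 0
    rw [hy.algebraMap_aevalEquiv]
    have h1 : eval₂Hom ρ v (aeval y g) = eval₂ ρ (fun i => eval₂ ρ v (y i)) g :=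
      eval₂Hom_bind₁ ρ v y g
    have h2 : (fun i => eval₂ ρ v (y i)) = fun i => ρ ((0 : Fin n → O) i) := by
      funext i; simp [hv]
    have h3 : eval₂ ρ (fun i => ρ ((0 : Fin n → O) i)) g = ρ (eval 0 g) :=
      (eval₂_comp_left ρ (RingHom.id O) (0 : Fin n → O) g).symm
    rw [h1, h2, h3, hg, map_zero]
  have hker : (RingHom.ker ψ).IsPrime := RingHom.ker_isPrime ψ
  -- Going-down. The quotient by `P` will be a lift of `v` on which all `y i` vanish.
  obtain ⟨P, hPQ, hP, hPo⟩ := Ideal.exists_ideal_le_liesOver_of_le (R := B) (p := RingHom.ker ψ)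
    (q := Q.under B) Q hle
  have hyP : ∀ i, y i ∈ P := fun i => by
    have h : (⟨y i, Algebra.subset_adjoin ⟨i, rfl⟩⟩ : B) ∈ RingHom.ker ψ := by
      have h1 : (⟨y i, Algebra.subset_adjoin ⟨i, rfl⟩⟩ : B) = e (X i) :=
        Subtype.ext (by
          have := hy.algebraMap_aevalEquiv (X i)
          rw [aeval_X] at this
          exact this.symm)
      rw [h1, RingHom.mem_ker]
      simp [ψ]
    rw [hPo.over] at h
    exact h
  have hPO : ∀ c : O, C c ∈ P → c = 0 := fun c hc => by
    have h : algebraMap O B c ∈ RingHom.ker ψ := by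
      rw [hPo.over]; exact hc
    rw [RingHom.mem_ker] at h
    have h1 : e.symm (algebraMap O B c) = C c := e.symm.commutes c
    simpa [ψ, h1] using h
  let T := MvPolynomial (Fin n) O ⧸ P
  have hTinj : Function.Injective (algebraMap O T) := by
    rw [injective_iff_map_eq_zero]
    intro c hc
    exact hPO c (Ideal.Quotient.eq_zero_iff_mem.1 hc)
  have hTdom : IsDomain T := Ideal.Quotient.isDomain P
  have hTfree : Module.IsTorsionFree O T :=
    Module.isTorsionFree_iff_algebraMap_injective.2 hTinj
  have hcomp : (Ideal.Quotient.mk P).comp (algebraMap B (MvPolynomial (Fin n) O)) =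
      (algebraMap O T).comp ψ := by
    refine RingHom.ext fun b => ?_
    have h : b - algebraMap O B (ψ b) ∈ RingHom.ker ψ := by
      have h1 : e.symm (algebraMap O B (ψ b)) = C (ψ b) := e.symm.commutes _
      have h2 : ψ (algebraMap O B (ψ b)) = ψ b := by
        change eval 0 (e.symm (algebraMap O B (ψ b))) = _
        rw [h1, eval_C]
      rw [RingHom.mem_ker, map_sub, h2, sub_self]
    rw [hPo.over] at h
    exact Ideal.Quotient.eq.2 h
  -- `B` acts on `T` through `ψ`, so monic equations over `B` become monic equations over `O`.
  have hTint : Algebra.IsIntegral O T := by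
    constructor
    intro t
    obtain ⟨p, rfl⟩ := Ideal.Quotient.mk_surjective t
    obtain ⟨q, hq, hqp⟩ := Algebra.IsIntegral.isIntegral (R := B) p
    refine ⟨q.map ψ, hq.map ψ, ?_⟩
    rw [Polynomial.eval₂_map, ← hcomp, ← Polynomial.hom_eval₂, hqp, map_zero]
  have hTalg : Algebra.IsAlgebraic O T := inferInstance
  let L : T →ₐ[O] K := IsAlgClosed.lift
  have hL : Function.Injective L := by
    rw [← RingHom.coe_coe, RingHom.injective_iff_ker_eq_bot]
    -- In a domain integral over `O`, a nonzero ideal meets `O` nontrivially.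
    refine Ideal.eq_bot_of_comap_eq_bot (R := O) ?_
    rw [RingHom.comap_ker, ← RingHom.injective_iff_ker_eq_bot]
    convert! hOinj using 1
    ext c
    exact L.commutes c
  -- The images of the coordinates in `K` are integral over `O`, hence belong to `O`.
  have hex : ∀ i, ∃ c : O, algebraMap O K c = L (Ideal.Quotient.mk P (X i)) := fun i =>
    (isIntegrallyClosedIn_iff.1 ‹_›).2 ((Algebra.IsIntegral.isIntegral (R := O)
      (Ideal.Quotient.mk P (X i))).map L)
  choose a ha using hex
  have haP : ∀ i, X i - C (a i) ∈ P := fun i => by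
    refine Ideal.Quotient.eq.1 (hL ?_)
    rw [← ha i]
    exact (L.commutes (a i)).symm
  refine ⟨a, fun i => ?_, fun i => ?_⟩
  · have h1 : Ideal.Quotient.mk P = (algebraMap O T).comp (eval a) := by
      refine MvPolynomial.ringHom_ext (fun c => ?_) fun j => ?_
      · rw [RingHom.comp_apply, eval_C]; rfl
      · rw [RingHom.comp_apply, eval_X]
        exact Ideal.Quotient.eq.2 (haP j)
    have h2 := congrArg (fun φ => φ (y i)) h1
    simp only [RingHom.comp_apply] at h2
    rw [Ideal.Quotient.eq_zero_iff_mem.2 (hyP i)] at h2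
    exact ((injective_iff_map_eq_zero _).1 hTinj _ h2.symm)
  -- `P ≤ Q` says that the lifted point reduces to `v`.
  · have h := hPQ (haP i)
    have h' : eval₂Hom ρ v (X i - C (a i)) = 0 := h
    rw [map_sub, coe_eval₂Hom, eval₂_X, eval₂_C, sub_eq_zero] at h'
    exact h'.symm

/-- A field that is integral over `ℤ` has positive characteristic, so every self-map of an affine
space over it that is given by polynomials has only preperiodic points. -/
theorem exists_iterate_eq_of_isIntegral_int {κ : Type*} [Field κ]
    (hκ : (Int.castRingHom κ).IsIntegral) {ι O : Type*} [Finite ι] [CommRing O] (ρ : O →+* κ)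
    (F : ι → MvPolynomial ι O) (v : ι → κ) :
    ∃ i j, i < j ∧ (fun w i => eval₂ ρ w (F i))^[i] v = (fun w i => eval₂ ρ w (F i))^[j] v := by
  have : Algebra.IsIntegral ℤ κ := ⟨hκ⟩
  have hchar : ∃ p : ℕ, p ≠ 0 ∧ (p : κ) = 0 := by
    obtain ⟨p, hp⟩ := CharP.exists κ
    refine ⟨p, ?_, hp.cast_eq_zero⟩
    rintro rfl
    have := CharP.charP_to_charZero κ
    exact Int.not_isField (isField_of_isIntegral_of_isField (R := ℤ) (S := κ)
      (by simpa using Int.cast_injective) (Field.toIsField κ))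
  obtain ⟨p, hp0, hp⟩ := hchar
  -- The ring `A` generated by the coefficients and the coordinates of `v` is a finitely generated
  -- `ℤ`-module killed by `p`, hence finite, and the orbit of `v` stays in it.
  set U : Set κ := (⋃ i, (fun s => ρ (coeff s (F i))) '' ((F i).support : Set (ι →₀ ℕ))) ∪
    Set.range v
  have hU : U.Finite :=
    (Set.finite_iUnion fun i => (Finset.finite_toSet _).image _).union (Set.finite_range v)
  set A : Subalgebra ℤ κ := Algebra.adjoin ℤ U
  have hAfg : Module.Finite ℤ A :=
    Module.Finite.iff_fg.2 (fg_adjoin_of_finite hU fun x _ => Algebra.IsIntegral.isIntegral x)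
  have hAfin : Finite A := by
    refine Module.finite_of_fg_torsion A fun {x} => ?_
    refine ⟨⟨(p : ℤ), mem_nonZeroDivisors_of_ne_zero (by exact_mod_cast hp0)⟩, ?_⟩
    refine Subtype.ext ?_
    change (((p : ℤ) • x : A) : κ) = 0
    simp [hp]
  have hmaps : ∀ k, (fun w i => eval₂ ρ w (F i))^[k] v ∈
      Set.pi Set.univ fun _ : ι => (A : Set κ) := by
    intro k
    induction k with
    | zero => exact fun i _ => Algebra.subset_adjoin (Or.inr ⟨i, rfl⟩)
    | succ k ih =>
      rw [Function.iterate_succ_apply']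
      intro i _
      exact MvPolynomial.eval₂_mem (s := A)
        (fun s hs => Algebra.subset_adjoin (Or.inl (Set.mem_iUnion.2 ⟨i, s, hs, rfl⟩)))
        fun j => ih j trivial
  obtain ⟨i, j, hij, h⟩ := Set.Finite.exists_lt_map_eq_of_forall_mem hmaps
    (Set.Finite.pi fun _ => Set.toFinite _ : (Set.pi Set.univ fun _ : ι => (A : Set κ)).Finite)
  exact ⟨i, j, hij, h⟩

/-- The quotient of an integral closure in an algebraically closed field by a maximal ideal is
algebraically closed. -/
theorem isAlgClosed_quotient_of_isIntegrallyClosedIn {O K : Type*} [CommRing O] [Field K]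
    [IsAlgClosed K] [Algebra O K] [IsIntegrallyClosedIn O K] (M : Ideal O) [M.IsMaximal] :
    letI := Ideal.Quotient.field M
    IsAlgClosed (O ⧸ M) := by
  let _ := Ideal.Quotient.field M
  refine IsAlgClosed.of_exists_root (O ⧸ M) fun p hp hirr => ?_
  obtain ⟨hinj, hint⟩ := isIntegrallyClosedIn_iff.1 ‹IsIntegrallyClosedIn O K›
  -- A root in `K` of a monic lift of `p` already lies in `O`, and it reduces to a root of `p`.
  obtain ⟨q, hqp, hdeg, hq⟩ := Polynomial.lifts_and_natDegree_eq_and_monic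
    (f := Ideal.Quotient.mk M) ((Polynomial.mem_lifts p).2
      (Polynomial.map_surjective _ Ideal.Quotient.mk_surjective p)) hp
  have : Nontrivial O := Ideal.Quotient.mk_surjective (I := M).nontrivial
  have hd : (q.map (algebraMap O K)).degree ≠ 0 := by
    rw [hq.degree_map, Polynomial.degree_eq_natDegree hq.ne_zero, hdeg]
    exact_mod_cast hirr.natDegree_pos.ne'
  obtain ⟨x, hx⟩ := IsAlgClosed.exists_root _ hd
  have hx' : Polynomial.eval₂ (algebraMap O K) x q = 0 := by
    rwa [Polynomial.IsRoot, Polynomial.eval_map] at hx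
  obtain ⟨c, rfl⟩ := hint ⟨q, hq, hx'⟩
  refine ⟨Ideal.Quotient.mk M c, ?_⟩
  have hc : q.eval c = 0 := by
    apply hinj
    rw [map_zero, ← hx', Polynomial.eval₂_at_apply]
  rw [← hqp, Polynomial.eval_map, Polynomial.eval₂_at_apply, hc, map_zero]

/-- If `x` lies in every maximal ideal, `x * x + 1` is a unit, so `±1`, which forces `x = 0`;
nonzero primes are maximal. -/
theorem isJacobsonRing_int : IsJacobsonRing ℤ := by
  rw [isJacobsonRing_iff_prime_eq]
  intro P hP
  by_cases hbot : P = ⊥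
  · subst hbot
    refine le_antisymm (fun x hx => ?_) Ideal.le_jacobson
    have h := Int.isUnit_iff.1 (Ideal.mem_jacobson_bot.1 hx x)
    rw [Ideal.mem_bot]
    rcases h with h | h
    · exact mul_self_eq_zero.1 (by linarith)
    · nlinarith [mul_self_nonneg x]
  · exact Ideal.jacobson_eq_self_of_isMaximal (H := hP.isMaximal hbot)

/-- If `R` is a finitely generated ring and `O` is integral over `R`, then the residue fields of
`O` are integral over `ℤ`. -/
theorem isIntegral_int_quotient {R O : Type*} [CommRing R] [CommRing O] [Algebra R O]
    [Algebra.FiniteType ℤ R] [Algebra.IsIntegral R O] (M : Ideal O) [M.IsMaximal] :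
    (Int.castRingHom (O ⧸ M)).IsIntegral := by
  have hm : (M.under R).IsMaximal := Ideal.isMaximal_comap_of_isIntegral_of_isMaximal M
  let _ := Ideal.Quotient.field (M.under R)
  have := isJacobsonRing_int
  -- Nullstellensatz over `ℤ`: a field of finite type over `ℤ` is finite over it.
  have h1 : Module.Finite ℤ (R ⧸ M.under R) := finite_of_finite_type_of_isJacobsonRing ℤ _
  have h2 : Algebra.IsIntegral (R ⧸ M.under R) (O ⧸ M) := inferInstance
  have h3 := (algebraMap_isIntegral_iff.2
    (Algebra.IsIntegral.of_finite ℤ (R ⧸ M.under R))).trans _ _ (algebraMap_isIntegral_iff.2 h2)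
  rwa [Subsingleton.elim (Int.castRingHom (O ⧸ M)) _]

/-- Forms over an algebraically closed field without a nontrivial common zero generate an ideal
whose radical contains all variables. -/
theorem X_mem_radical_span_of_no_common_zero {K ι : Type*} [Field K] [IsAlgClosed K] [Finite ι]
    {F : ι → MvPolynomial ι K} (hF : ∀ v : ι → K, v ≠ 0 → ∃ i, eval v (F i) ≠ 0) (i : ι) :
    (X i : MvPolynomial ι K) ∈ (Ideal.span (Set.range F)).radical := by
  rw [← vanishingIdeal_zeroLocus_eq_radical (K := K), mem_vanishingIdeal_iff]
  intro v hv
  by_cases h : v = 0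
  · simp [h]
  obtain ⟨j, hj⟩ := hF v h
  refine absurd ?_ hj
  have := hv (F j) (Ideal.subset_span ⟨j, rfl⟩)
  simpa using this

/-- A family of forms without common zero over an algebraically closed field `K` can be defined
over a subring that is integrally closed in `K` and whose residue fields are integral over `ℤ`, in
such a way that the variables are still nilpotent modulo the forms. -/
theorem exists_integral_model {K ι : Type*} [Field K] [IsAlgClosed K] [Finite ι]
    {F : ι → MvPolynomial ι K} (hF : ∀ v : ι → K, v ≠ 0 → ∃ i, eval v (F i) ≠ 0) :
    ∃ O : Subring K, IsIntegrallyClosedIn O K ∧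
      (∀ M : Ideal O, M.IsMaximal → (Int.castRingHom (O ⧸ M)).IsIntegral) ∧
      ∃ F' : ι → MvPolynomial ι O, (∀ i, map (algebraMap O K) (F' i) = F i) ∧
        ∀ i, (X i : MvPolynomial ι O) ∈ (Ideal.span (Set.range F')).radical := by
  have := Fintype.ofFinite ι
  choose N hN using X_mem_radical_span_of_no_common_zero hF
  simp only [Ideal.mem_span_range_iff_exists_fun] at hN
  choose c hc using hN
  -- The coefficients of the `c i j` are included so that the identities `X i ^ N i = ∑ c i j * F j`
  -- descend to `O`.
  set U : Set K := (⋃ i, ((F i).coeffs : Set K)) ∪ ⋃ i, ⋃ j, ((c i j).coeffs : Set K)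
  have hU : U.Finite := (Set.finite_iUnion fun i => Finset.finite_toSet _).union
    (Set.finite_iUnion fun i => Set.finite_iUnion fun j => Finset.finite_toSet _)
  let R : Subalgebra ℤ K := Algebra.adjoin ℤ U
  have hR : Algebra.FiniteType ℤ R := by
    rw [← Subalgebra.fg_iff_finiteType]
    exact Subalgebra.fg_def.2 ⟨U, hU, rfl⟩
  let O : Subalgebra R K := integralClosure R K
  have hUO : U ⊆ Set.range (algebraMap O K) := fun x hx => by
    have : x ∈ O := isIntegral_algebraMap (R := R) (x := ⟨x, Algebra.subset_adjoin hx⟩)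
    exact ⟨⟨x, this⟩, rfl⟩
  have hF' : ∀ i, F i ∈ Set.range (map (algebraMap O K)) := fun i =>
    mem_range_map_iff_coeffs_subset.2 fun x hx =>
      hUO (Or.inl (Set.mem_iUnion.2 ⟨i, hx⟩))
  have hc' : ∀ i j, c i j ∈ Set.range (map (algebraMap O K)) := fun i j =>
    mem_range_map_iff_coeffs_subset.2 fun x hx =>
      hUO (Or.inr (Set.mem_iUnion.2 ⟨i, Set.mem_iUnion.2 ⟨j, hx⟩⟩))
  choose F' hF' using hF'
  choose c' hc' using hc'
  have hinj : Function.Injective (algebraMap O K) := Subtype.coe_injective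
  refine ⟨O.toSubring, inferInstanceAs (IsIntegrallyClosedIn O K), fun M hM => ?_, F', hF',
    fun i => ⟨N i, ?_⟩⟩
  · exact isIntegral_int_quotient (R := R) (O := O) M
  · refine Ideal.mem_span_range_iff_exists_fun.2 ⟨c' i, ?_⟩
    apply map_injective (algebraMap O K) hinj
    have := hc i
    simp only [map_sum, map_mul, map_pow, map_X]
    simpa only [hc', hF'] using this

/-- A self-map of affine space given by forms of degree at least two without common zero has
preperiodic points in infinitely many directions. -/
theorem infinite_ratio_preperiodic {K : Type*} [Field K] [IsAlgClosed K] {n d : ℕ} (hd : 2 ≤ d)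
    {F : Fin n → MvPolynomial (Fin n) K} (hFd : ∀ i, (F i).IsHomogeneous d)
    (hF : ∀ v : Fin n → K, v ≠ 0 → ∃ i, eval v (F i) ≠ 0) {k l : Fin n} (hkl : k ≠ l) :
    {s : K | ∃ a : Fin n → K, a k ≠ 0 ∧ a l = s * a k ∧ ∃ i j, i < j ∧
      (fun w i => eval w (F i))^[i] a = (fun w i => eval w (F i))^[j] a}.Infinite := by
  obtain ⟨O, hO, hκ, F', hF', hrad⟩ := exists_integral_model hF
  have hinj : Function.Injective (algebraMap O K) := Subtype.coe_injective
  obtain ⟨M, hM⟩ := Ideal.exists_maximal O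
  let _ := Ideal.Quotient.field M
  have : IsAlgClosed (O ⧸ M) := isAlgClosed_quotient_of_isIntegrallyClosedIn (K := K) M
  have : Infinite (O ⧸ M) := IsAlgClosed.instInfinite
  let ρ : O →+* O ⧸ M := Ideal.Quotient.mk M
  have hFd' : ∀ i, (F' i).IsHomogeneous d := fun i => by
    refine IsHomogeneous.of_map hinj ?_
    rw [hF']; exact hFd i
  have key : ∀ t : O ⧸ M, ∃ a : Fin n → O, ρ (a k) = 1 ∧ ρ (a l) = t ∧ ∃ i j, i < j ∧
      (fun w i => eval w (F' i))^[i] a = (fun w i => eval w (F' i))^[j] a := by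
    intro t
    -- Only the entries `1` at `k` and `t` at `l` matter: they make the ratio of the lifted
    -- coordinates reduce to `t`.
    let v : Fin n → O ⧸ M := Function.update (fun _ => t) k 1
    obtain ⟨i, j, hij, h⟩ := exists_iterate_eq_of_isIntegral_int (hκ M hM) ρ F' v
    have hint := isIntegral_adjoin_of_leadingForms (H := iterPoly F' j) (G := iterPoly F' i)
      (isHomogeneous_iterPoly hFd' j)
      (fun m => (isHomogeneous_iterPoly hFd' i m).totalDegree_le.trans_lt
        (Nat.pow_lt_pow_right (by omega) hij))
      (X_mem_radical_span_iterPoly hrad j)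
    obtain ⟨a, ha0, hav⟩ := exists_lift_of_common_zero (K := K) ρ
      (fun m => iterPoly F' j m - iterPoly F' i m) v (fun m => by
        rw [eval₂_sub, sub_eq_zero]
        have := congrFun h m
        rw [← eval₂_iterPoly, ← eval₂_iterPoly] at this
        exact this.symm)
    refine ⟨a, by simp [hav, v], by simp [hav, v, hkl.symm], i, j, hij, ?_⟩
    have e1 := eval₂_iterPoly F' (RingHom.id O) a i
    have e2 := eval₂_iterPoly F' (RingHom.id O) a j
    simp only [eval₂_id] at e1 e2
    rw [← e1, ← e2]
    funext m
    have := ha0 m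
    rw [map_sub, sub_eq_zero] at this
    exact this.symm
  choose a hak hal hper using key
  have hne : ∀ t, algebraMap O K (a t k) ≠ 0 := fun t h0 => by
    have h1 : a t k = 0 := hinj (by rw [h0, map_zero])
    have h2 := hak t
    rw [h1, map_zero] at h2
    exact zero_ne_one h2
  refine Set.infinite_of_injective_forall_mem
    (f := fun t => algebraMap O K (a t l) / algebraMap O K (a t k)) ?_ ?_
  · intro t u htu
    have h1 : a t l * a u k = a u l * a t k := by
      apply hinj
      have := (div_eq_div_iff (hne t) (hne u)).1 htu
      simpa using this
    have h2 := congrArg ρ h1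
    simpa [hak, hal] using h2
  · intro t
    obtain ⟨i, j, hij, h⟩ := hper t
    refine ⟨fun m => algebraMap O K (a t m), hne t, (div_mul_cancel₀ _ (hne t)).symm, i, j, hij, ?_⟩
    have hsemi : Function.Semiconj (fun (w : Fin n → O) m => algebraMap O K (w m))
        (fun w i => eval w (F' i)) (fun w i => eval w (F i)) := fun w => by
      funext m
      change algebraMap O K (eval w (F' m)) = eval (fun m => algebraMap O K (w m)) (F m)
      rw [← hF' m, eval_map]
      exact eval₂_comp_left (algebraMap O K) (RingHom.id O) w (F' m)
    have e1 := (hsemi.iterate_right i) (a t)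
    have e2 := (hsemi.iterate_right j) (a t)
    rw [← e1, ← e2, h]

/-! ### Homogeneity of factors -/

section Forms

variable {σ K : Type*} [Field K]

theorem eval_smul_of_isHomogeneous {p : MvPolynomial σ K} {k : ℕ}
    (hp : p.IsHomogeneous k) (c : K) (v : σ → K) : eval (c • v) p = c ^ k * eval v p := by
  rw [eval_eq, eval_eq, Finset.mul_sum]
  refine Finset.sum_congr rfl fun s hs => ?_
  rw [hp.degree_eq_sum_deg_support hs]
  simp only [Pi.smul_apply, smul_eq_mul, mul_pow, Finset.prod_mul_distrib,
    Finset.prod_pow_eq_pow_sum]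
  ring

/-- The substitution `X i ↦ X i * T`, which records degrees in powers of `T`. -/
noncomputable def degreeMarker : MvPolynomial σ K →ₐ[K] Polynomial (MvPolynomial σ K) :=
  aeval fun i => Polynomial.C (X i) * Polynomial.X

theorem degreeMarker_monomial (s : σ →₀ ℕ) (r : K) :
    degreeMarker (monomial s r) = Polynomial.monomial s.degree (monomial s r) := by
  rw [degreeMarker, aeval_monomial, ← Polynomial.C_mul_X_pow_eq_monomial, monomial_eq, map_mul,
    map_finsuppProd]
  simp only [mul_pow, Finsupp.prod_mul, map_pow, mul_assoc]
  simp only [Finsupp.prod, Finset.prod_pow_eq_pow_sum]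
  rfl

theorem coeff_degreeMarker (p : MvPolynomial σ K) (k : ℕ) :
    (degreeMarker p).coeff k = homogeneousComponent k p := by
  induction p using MvPolynomial.induction_on' with
  | monomial s r =>
    rw [degreeMarker_monomial, Polynomial.coeff_monomial]
    split_ifs with h
    · exact (homogeneousComponent_eq_self (isHomogeneous_monomial r h)).symm
    · rw [homogeneousComponent_of_mem (isHomogeneous_monomial r rfl), if_neg (Ne.symm h)]
  | add p q hp hq => rw [map_add, map_add, Polynomial.coeff_add, hp, hq]

theorem degreeMarker_of_isHomogeneous {p : MvPolynomial σ K} {k : ℕ} (hp : p.IsHomogeneous k) :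
    degreeMarker p = Polynomial.monomial k p := by
  ext1 j
  rw [coeff_degreeMarker, homogeneousComponent_of_mem hp, Polynomial.coeff_monomial]
  simp [eq_comm]

/-- The factors of a nonzero form are forms. -/
theorem exists_isHomogeneous_of_mul {p q : MvPolynomial σ K} {k : ℕ}
    (h : (p * q).IsHomogeneous k) (h0 : p * q ≠ 0) :
    ∃ a b, p.IsHomogeneous a ∧ q.IsHomogeneous b ∧ a + b = k := by
  have hinj : ∀ p : MvPolynomial σ K, p ≠ 0 → degreeMarker p ≠ 0 := fun p hp h' => by
    apply hp
    rw [← sum_homogeneousComponent p]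
    refine Finset.sum_eq_zero fun i _ => ?_
    rw [← coeff_degreeMarker, h', Polynomial.coeff_zero]
  have hp := hinj p (left_ne_zero_of_mul h0)
  have hq := hinj q (right_ne_zero_of_mul h0)
  have hm : degreeMarker p * degreeMarker q = Polynomial.monomial k (p * q) := by
    rw [← map_mul, degreeMarker_of_isHomogeneous h]
  -- Top and lowest degrees in `T` are both additive, and both sums equal `k`; so they agree for
  -- each factor.
  have h1 : (degreeMarker p).natDegree + (degreeMarker q).natDegree = k := by
    rw [← Polynomial.natDegree_mul hp hq, hm, Polynomial.natDegree_monomial_eq _ h0]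
  have h2 : (degreeMarker p).natTrailingDegree + (degreeMarker q).natTrailingDegree = k := by
    rw [← Polynomial.natTrailingDegree_mul hp hq, hm, Polynomial.natTrailingDegree_monomial h0]
  have hp' := Polynomial.natTrailingDegree_le_natDegree (degreeMarker p)
  have hq' := Polynomial.natTrailingDegree_le_natDegree (degreeMarker q)
  have hhom : ∀ p : MvPolynomial σ K,
      (degreeMarker p).natTrailingDegree = (degreeMarker p).natDegree →
      p.IsHomogeneous (degreeMarker p).natDegree := fun p hp => by
    have : p = homogeneousComponent (degreeMarker p).natDegree p := by
      conv_lhs => rw [← sum_homogeneousComponent p]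
      refine Finset.sum_eq_single _ (fun i _ hi => ?_) fun hi => ?_
      · rw [← coeff_degreeMarker]
        rcases lt_or_gt_of_ne hi with hi | hi
        · exact Polynomial.coeff_eq_zero_of_lt_natTrailingDegree (hp ▸ hi)
        · exact Polynomial.coeff_eq_zero_of_natDegree_lt hi
      · exact homogeneousComponent_eq_zero _ _ (by simpa using hi)
    have hh := homogeneousComponent_isHomogeneous (degreeMarker p).natDegree p
    rwa [← this] at hh
  exact ⟨_, _, hhom p (by omega), hhom q (by omega), h1⟩

end Forms

/-! ### Zero loci and their irreducible components -/

section ZeroLoci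

variable {K : Type*} [Field K] {n : ℕ}

theorem isClosed_iff_isZariskiClosed {V : Type*} [AddCommGroup V] [Module K V]
    {Z : Set (ℙ K V)} : IsClosed Z ↔ IsZariskiClosed Z := by
  rw [← isOpen_compl_iff]
  change IsZariskiClosed Zᶜᶜ ↔ _
  rw [compl_compl]

/-- The zero locus of a polynomial in projective space; only used for forms. -/
def formLocus (A : MvPolynomial (Fin (n + 1)) K) : Set (ProjSpace K n) :=
  {x | eval x.rep A = 0}

theorem mk_mem_formLocus {A : MvPolynomial (Fin (n + 1)) K} {a : ℕ} (hA : A.IsHomogeneous a)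
    {v : Fin (n + 1) → K} (hv : v ≠ 0) (h : eval v A = 0) :
    Projectivization.mk K v hv ∈ formLocus A := by
  obtain ⟨c, hc⟩ := Projectivization.exists_smul_eq_mk_rep K v hv
  change eval (Projectivization.mk K v hv).rep A = 0
  rw [← hc, Units.smul_def, eval_smul_of_isHomogeneous hA, h, mul_zero]

theorem isClosed_formLocus {A : MvPolynomial (Fin (n + 1)) K} {a : ℕ} (hA : A.IsHomogeneous a) :
    IsClosed (formLocus A) := by
  refine isClosed_iff_isZariskiClosed.2
    ⟨{rename (fun i => (LinearMap.proj i : Module.Dual K (Fin (n + 1) → K))) A}, ?_, ?_⟩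
  · rintro p rfl
    exact ⟨a, hA.rename_isHomogeneous⟩
  · ext x
    simp [formLocus, projZeroLocus, eval_rename, Function.comp_def]

/-- A polynomial in the linear forms on `K ^ (n + 1)`, as a polynomial in the coordinates. -/
noncomputable def toCoords :
    MvPolynomial (Module.Dual K (Fin (n + 1) → K)) K →ₐ[K] MvPolynomial (Fin (n + 1)) K :=
  aeval fun φ => ∑ i, C (φ (Pi.single i 1)) * X i

theorem eval_toCoords (p : MvPolynomial (Module.Dual K (Fin (n + 1) → K)) K)
    (v : Fin (n + 1) → K) : eval v (toCoords p) = eval (fun φ => φ v) p := by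
  have h : ∀ φ : Module.Dual K (Fin (n + 1) → K),
      eval v (∑ i, C (φ (Pi.single i 1)) * X i) = φ v := fun φ => by
    simp only [map_sum, map_mul, eval_C, eval_X]
    conv_rhs => rw [← Finset.univ_sum_single v, map_sum]
    refine Finset.sum_congr rfl fun i _ => ?_
    rw [← mul_one (v i), ← smul_eq_mul (v i) 1, Pi.single_smul, map_smul]
    simp [mul_comm]
  rw [← funext h]
  exact eval₂Hom_bind₁ (RingHom.id K) v _ p

theorem isHomogeneous_toCoords {p : MvPolynomial (Module.Dual K (Fin (n + 1) → K)) K} {k : ℕ}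
    (hp : p.IsHomogeneous k) : (toCoords p).IsHomogeneous k := by
  have := hp.aeval (fun φ : Module.Dual K (Fin (n + 1) → K) =>
    ∑ i, (C (φ (Pi.single i 1)) * X i : MvPolynomial (Fin (n + 1)) K)) (n := 1)
    (fun φ => IsHomogeneous.sum _ _ _ fun i _ => isHomogeneous_C_mul_X _ _)
  simpa [toCoords] using this

/-- The zero locus of an irreducible form is irreducible as soon as it is nonempty. -/
theorem isIrreducible_formLocus [IsAlgClosed K] {A : MvPolynomial (Fin (n + 1)) K} {a : ℕ}
    (hA : A.IsHomogeneous a) (hirr : Irreducible A) (hne : (formLocus A).Nonempty) :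
    IsIrreducible (formLocus A) := by
  refine ⟨hne, isPreirreducible_iff_isClosed_union_isClosed.2 fun Z₁ Z₂ hZ₁ hZ₂ hsub => ?_⟩
  obtain ⟨S, hS, rfl⟩ := isClosed_iff_isZariskiClosed.1 hZ₁
  obtain ⟨T, hT, rfl⟩ := isClosed_iff_isZariskiClosed.1 hZ₂
  by_contra! hcon
  obtain ⟨h1, h2⟩ := hcon
  obtain ⟨x, hxA, hx⟩ := Set.not_subset.1 h1
  obtain ⟨y, hyA, hy⟩ := Set.not_subset.1 h2
  simp only [projZeroLocus, Set.mem_ofPred_eq, not_forall] at hx hy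
  obtain ⟨p, hp, hpx⟩ := hx
  obtain ⟨q, hq, hqy⟩ := hy
  obtain ⟨k, hk⟩ := hS p hp
  obtain ⟨l, hl⟩ := hT q hq
  rw [← eval_toCoords] at hpx hqy
  have hhom := (isHomogeneous_toCoords hk).mul (isHomogeneous_toCoords hl)
  have hrep : ∀ z ∈ formLocus A, eval z.rep (toCoords p * toCoords q) = 0 := fun z hz => by
    rw [map_mul, eval_toCoords, eval_toCoords]
    rcases hsub hz with h | h
    · rw [h p hp, zero_mul]
    · rw [h q hq, mul_zero]
  have hvan : toCoords p * toCoords q ∈ (Ideal.span {A}).radical := by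
    rw [← vanishingIdeal_zeroLocus_eq_radical (K := K), mem_vanishingIdeal_iff]
    intro v hv
    have hvA : eval v A = 0 := by
      simpa using hv A (Ideal.subset_span rfl)
    change eval v _ = 0
    by_cases hv0 : v = 0
    -- Writing the origin as a multiple of a point of the locus also covers a product of degree `0`,
    -- which need not vanish there automatically.
    · rw [hv0, ← zero_smul K x.rep, eval_smul_of_isHomogeneous hhom, hrep x hxA, mul_zero]
    · have h := hrep _ (mk_mem_formLocus hA hv0 hvA)
      obtain ⟨c, hc⟩ := Projectivization.exists_smul_eq_mk_rep K v hv0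
      rw [← hc, Units.smul_def, eval_smul_of_isHomogeneous hhom] at h
      exact (mul_eq_zero.1 h).resolve_left (pow_ne_zero _ c.ne_zero)
  have hprime : (Ideal.span {A}).IsPrime :=
    (Ideal.span_singleton_prime hirr.ne_zero).2 hirr.prime
  rw [hprime.radical] at hvan
  rcases hprime.mem_or_mem hvan with h | h
  · obtain ⟨c, hc⟩ := Ideal.mem_span_singleton'.1 h
    exact hpx (by rw [← hc, map_mul, show eval x.rep A = 0 from hxA, mul_zero])
  · obtain ⟨c, hc⟩ := Ideal.mem_span_singleton'.1 h
    exact hqy (by rw [← hc, map_mul, show eval y.rep A = 0 from hyA, mul_zero])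

/-- Every irreducible component of a hypersurface that is cut out by a product of irreducible
forms with nonempty zero loci is the zero locus of one of the factors. -/
theorem exists_eq_formLocus_of_isIrreducibleComponentOf [IsAlgClosed K] {r : ℕ}
    {A : Fin r → MvPolynomial (Fin (n + 1)) K} {e : Fin r → ℕ}
    (hA : ∀ i, (A i).IsHomogeneous (e i)) (hirr : ∀ i, Irreducible (A i))
    (hne : ∀ i, (formLocus (A i)).Nonempty) {Z : Set (ProjSpace K n)}
    (hZ : IsIrreducibleComponentOf Z (formLocus (∏ i, A i))) : ∃ i, Z = formLocus (A i) := by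
  classical
  obtain ⟨⟨hZi, hZs⟩, hmax⟩ := hZ
  have hmem : ∀ x : ProjSpace K n, x ∈ formLocus (∏ i, A i) ↔ ∃ i, x ∈ formLocus (A i) :=
    fun x => by simp [formLocus, Finset.prod_eq_zero_iff]
  -- An irreducible set covered by finitely many closed sets lies in one of them; maximality then
  -- gives equality.
  obtain ⟨W, hW, hZW⟩ := isIrreducible_iff_sUnion_isClosed.1 hZi
    (Finset.univ.image fun i => formLocus (A i))
    (by simpa using fun i => isClosed_formLocus (hA i))
    (fun x hx => by simpa using (hmem x).1 (hZs hx))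
  obtain ⟨i, -, rfl⟩ := Finset.mem_image.1 hW
  refine ⟨i, hZW.antisymm (hmax ⟨isIrreducible_formLocus (hA i) (hirr i) (hne i), fun x hx =>
    (hmem x).2 ⟨i, hx⟩⟩ hZW)⟩

end ZeroLoci

/-! ### Deforming forms through prescribed points -/

section Deformation

variable {K : Type*} [Field K] {σ : Type*}

/-- If `g` is polynomial on lines and does not vanish at `A * C` for a form `A` of positive degree,
then `A` can be deformed so as to vanish at one of infinitely many given points, without `g`
becoming zero. -/
theorem exists_deformation_through_point {g : MvPolynomial σ K → K}
    (hg : ∀ P Q, ∃ q : Polynomial K, ∀ t, q.eval t = g (P + C t * Q)) {k l : σ} {S : Set K}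
    (hS : S.Infinite) {pt : K → σ → K} (hk : ∀ s ∈ S, pt s k = 1) (hl : ∀ s ∈ S, pt s l = s)
    {A B : MvPolynomial σ K} {a : ℕ} (ha : 1 ≤ a) (hA : A.IsHomogeneous a) (hAB : g (A * B) ≠ 0) :
    ∃ A' : MvPolynomial σ K, A'.IsHomogeneous a ∧ (∃ s ∈ S, eval (pt s) A' = 0) ∧
      g (A' * B) ≠ 0 := by
  -- On the line `A + t * D` only finitely many `t` make `g` vanish, so infinitely many `t` hitting
  -- a point suffice.
  have key : ∀ D : MvPolynomial σ K, D.IsHomogeneous a →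
      {t | ∃ s ∈ S, eval (pt s) A + t * eval (pt s) D = 0}.Infinite →
      ∃ A' : MvPolynomial σ K, A'.IsHomogeneous a ∧ (∃ s ∈ S, eval (pt s) A' = 0) ∧
        g (A' * B) ≠ 0 := fun D hD hinf => by
    classical
    obtain ⟨q, hq⟩ := hg (A * B) (D * B)
    have hq0 : q ≠ 0 := by
      rintro rfl
      apply hAB
      simpa using (hq 0).symm
    obtain ⟨t, ⟨s, hs, hts⟩, htq⟩ := hinf.exists_notMem_finset q.roots.toFinset
    refine ⟨A + C t * D, hA.add (by simpa using hD.C_mul t), ⟨s, hs, by simpa using hts⟩, ?_⟩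
    rw [add_mul, mul_assoc, ← hq]
    simpa [hq0] using htq
  -- If `A` takes infinitely many values on the points, `D = X k ^ a`, with value `1` there, works.
  -- Otherwise some value `c` recurs infinitely often; for `c ≠ 0`, `D = X k ^ (a - 1) * X l` has
  -- value `s`, giving `t = -c / s`.
  by_cases him : ((fun s => eval (pt s) A) '' S).Finite
  · obtain ⟨c, hc⟩ : ∃ c, {s ∈ S | eval (pt s) A = c}.Infinite := by
      by_contra! hcon
      refine hS (Set.Finite.of_finite_fibers (fun s => eval (pt s) A) him fun c _ => ?_)
      exact hcon c
    by_cases hc0 : c = 0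
    · obtain ⟨s, hs, hsc⟩ := hc.nonempty
      exact ⟨A, hA, ⟨s, hs, hsc.trans hc0⟩, hAB⟩
    · refine key (X k ^ (a - 1) * X l) ?_ ?_
      · have := (isHomogeneous_X_pow (R := K) k (a - 1)).mul (isHomogeneous_X K l)
        rwa [Nat.sub_add_cancel ha] at this
      · refine ((hc.sdiff (Set.finite_singleton 0)).image (f := fun s => -c / s) ?_).mono ?_
        · rintro s ⟨-, hs⟩ u ⟨-, hu⟩ hsu
          have hs : s ≠ 0 := hs
          have hu : u ≠ 0 := hu
          have := (div_eq_div_iff hs hu).1 hsu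
          exact (mul_left_cancel₀ (neg_ne_zero.2 hc0) this).symm
        · rintro _ ⟨s, ⟨⟨hs, hsc⟩, hs0⟩, rfl⟩
          have hs0 : s ≠ 0 := hs0
          refine ⟨s, hs, ?_⟩
          simp [hsc, hk s hs, hl s hs, div_mul_cancel₀ _ hs0]
  · refine key (X k ^ a) (isHomogeneous_X_pow k a) ?_
    have him : ((fun s => eval (pt s) A) '' S).Infinite := him
    refine (him.image (f := Neg.neg) neg_injective.injOn).mono ?_
    rintro _ ⟨_, ⟨s, hs, rfl⟩, rfl⟩
    exact ⟨s, hs, by simp [hk s hs]⟩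

/-- If `g` is polynomial on lines and does not vanish at some form of degree `m`, then it does not
vanish at some product of irreducible forms each of which has a zero among infinitely many given
points. -/
theorem exists_irreducible_factors_through_points {g : MvPolynomial σ K → K} (hg0 : g 0 = 0)
    (hg : ∀ P Q, ∃ q : Polynomial K, ∀ t, q.eval t = g (P + C t * Q)) {k l : σ} {S : Set K}
    (hS : S.Infinite) {pt : K → σ → K} (hk : ∀ s ∈ S, pt s k = 1) (hl : ∀ s ∈ S, pt s l = s)
    {m : ℕ} (hm : 1 ≤ m) {Φ : MvPolynomial σ K} (hΦ : Φ.IsHomogeneous m) (hgΦ : g Φ ≠ 0) :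
    ∃ (r : ℕ) (e : Fin r → ℕ) (A : Fin r → MvPolynomial σ K),
      (∀ i, (A i).IsHomogeneous (e i)) ∧ ∑ i, e i = m ∧ (∀ i, Irreducible (A i)) ∧
      (∀ i, ∃ s ∈ S, eval (pt s) (A i) = 0) ∧ g (∏ i, A i) ≠ 0 := by
  classical
  -- A maximal `r` is taken here: deforming factors keeps their degrees, and a reducible factor
  -- would yield `r + 1` factors.
  let Good : ℕ → Prop := fun r => ∃ (e : Fin r → ℕ) (A : Fin r → MvPolynomial σ K),
    (∀ i, (A i).IsHomogeneous (e i)) ∧ (∀ i, 1 ≤ e i) ∧ ∑ i, e i = m ∧ g (∏ i, A i) ≠ 0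
  have hbound : ∀ r, Good r → r ≤ m := by
    rintro r ⟨e, -, -, he, hsum, -⟩
    rw [← hsum]
    simpa using Finset.sum_le_sum fun i (_ : i ∈ Finset.univ) => he i
  have h1 : Good 1 := ⟨fun _ => m, fun _ => Φ, fun _ => hΦ, fun _ => hm, by simp, by simpa⟩
  obtain ⟨r, hr, hmax⟩ : ∃ r, Good r ∧ ¬ Good (r + 1) := by
    refine ⟨Nat.findGreatest Good m, Nat.findGreatest_spec hm h1, fun h => ?_⟩
    exact absurd (Nat.le_findGreatest (hbound _ h) h) (by omega)
  obtain ⟨e, A, hA, he, hsum, hgA⟩ := hr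
  have hdeform : ∀ T : Finset (Fin r), ∃ A : Fin r → MvPolynomial σ K,
      (∀ i, (A i).IsHomogeneous (e i)) ∧ g (∏ i, A i) ≠ 0 ∧
      ∀ i ∈ T, ∃ s ∈ S, eval (pt s) (A i) = 0 := by
    intro T
    induction T using Finset.induction_on with
    | empty => exact ⟨A, hA, hgA, by simp⟩
    | insert j T _ ih =>
      obtain ⟨A, hA, hgA, hT⟩ := ih
      rw [← Finset.mul_prod_erase _ _ (Finset.mem_univ j)] at hgA
      obtain ⟨A', hA', hs, hg'⟩ := exists_deformation_through_point hg hS hk hl (he j) (hA j) hgA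
      refine ⟨Function.update A j A', fun i => ?_, ?_, fun i hi => ?_⟩
      · rcases eq_or_ne i j with rfl | hij
        · simpa using hA'
        · simpa [hij] using hA i
      · rwa [Finset.prod_update_of_mem (Finset.mem_univ j), Finset.sdiff_singleton_eq_erase]
      · rcases eq_or_ne i j with rfl | hij
        · simpa using hs
        · simpa [hij] using hT i (Finset.mem_of_mem_insert_of_ne hi hij)
  obtain ⟨A, hA, hgA, hT⟩ := hdeform Finset.univ
  refine ⟨r, e, A, hA, hsum, fun j => ?_, fun i => hT i (Finset.mem_univ i), hgA⟩
  have hprod : ∏ i, A i ≠ 0 := fun h => hgA (by rw [h, hg0])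
  have hunit : ∀ {P : MvPolynomial σ K} {b : ℕ}, P ≠ 0 → P.IsHomogeneous b →
      (¬ IsUnit P ↔ 1 ≤ b) := by
    intro P b hP hPb
    rw [Nat.one_le_iff_ne_zero, not_iff_not, MvPolynomial.isUnit_iff_totalDegree_of_isReduced,
      hPb.totalDegree hP]
    constructor
    · exact fun h => h.2
    · rintro rfl
      refine ⟨?_, rfl⟩
      rw [isUnit_iff_ne_zero]
      intro h0
      apply hP
      rw [totalDegree_eq_zero_iff_eq_C.1 (hPb.totalDegree hP), h0, C_0]
  have hj0 : A j ≠ 0 := Finset.prod_ne_zero_iff.1 hprod j (Finset.mem_univ j)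
  refine ⟨(hunit hj0 (hA j)).2 (he j), fun {P Q} hPQ => ?_⟩
  by_contra! hcon
  have hPQ0 : P * Q ≠ 0 := hPQ ▸ hj0
  obtain ⟨b, c, hb, hc, hbc⟩ := exists_isHomogeneous_of_mul (hPQ ▸ hA j) hPQ0
  have hb1 := (hunit (left_ne_zero_of_mul hPQ0) hb).1 hcon.1
  have hc1 := (hunit (right_ne_zero_of_mul hPQ0) hc).1 hcon.2
  refine hmax ⟨Fin.cons b (Function.update e j c), Fin.cons P (Function.update A j Q),
    ?_, ?_, ?_, ?_⟩
  · refine Fin.cases (by simpa using hb) fun i => ?_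
    rcases eq_or_ne i j with rfl | hij
    · simpa using hc
    · simpa [hij] using hA i
  · refine Fin.cases (by simpa using hb1) fun i => ?_
    rcases eq_or_ne i j with rfl | hij
    · simpa using hc1
    · simpa [hij] using he i
  · rw [Fin.sum_univ_succ]
    simp only [Fin.cons_zero, Fin.cons_succ]
    rw [Finset.sum_update_of_mem (Finset.mem_univ j), ← add_assoc, hbc,
      Finset.sdiff_singleton_eq_erase, Finset.add_sum_erase _ _ (Finset.mem_univ j), hsum]
  · rw [Fin.prod_univ_succ]
    simp only [Fin.cons_zero, Fin.cons_succ]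
    rwa [Finset.prod_update_of_mem (Finset.mem_univ j), ← mul_assoc, ← hPQ,
      Finset.sdiff_singleton_eq_erase, Finset.mul_prod_erase _ _ (Finset.mem_univ j)]

end Deformation

/-! ### Preperiodic points and dynamical improperness -/

section Dynamics

/-- The images of a set containing a preperiodic point under infinitely many iterates of a map have
a common point. -/
theorem exists_strictMono_iterates_nonempty {X : Type*} {f : X → X} {Z : Set X} {x : X}
    (hx : x ∈ Z) {i j : ℕ} (hij : i < j) (h : f^[i] x = f^[j] x) {r : ℕ} (hr : 0 < r) (N : ℕ) :
    ∃ u : Fin N → ℕ, StrictMono u ∧ (⋂ k, (f^[r])^[u k] '' Z).Nonempty := by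
  obtain ⟨p, rfl⟩ := Nat.exists_eq_add_of_lt hij
  set q := p + 1
  have hper : Function.IsPeriodicPt f q (f^[i] x) := by
    change f^[q] (f^[i] x) = f^[i] x
    rw [← Function.iterate_add_apply, h]
    rw [show i + p + 1 = q + i by omega]
  -- The exponents `r * ((i + k) * q)` are at least `i` and all divisible by the period `q`, so they
  -- send `x` to one point.
  refine ⟨fun k => (i + k) * q, fun a b hab => ?_, f^[r * (i * q)] x, ?_⟩
  · exact Nat.mul_lt_mul_of_pos_right (by simpa using hab) (Nat.succ_pos p)
  · rw [Set.mem_iInter]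
    refine fun k => ⟨x, hx, ?_⟩
    rw [← Function.iterate_mul]
    have hle : i ≤ r * (i * q) :=
      (Nat.le_mul_of_pos_right i (Nat.succ_pos p)).trans (Nat.le_mul_of_pos_left _ hr)
    obtain ⟨w, hw⟩ := Nat.exists_eq_add_of_le hle
    have hper' : Function.IsPeriodicPt f q (f^[r * (i * q)] x) := by
      rw [hw, add_comm, Function.iterate_add_apply]
      exact hper.apply_iterate w
    have hmul := hper'.const_mul (r * k)
    have e : r * ((i + k) * q) = r * k * q + r * (i * q) := by ring
    rw [e, Function.iterate_add_apply]
    exact hmul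

variable {K : Type*} [Field K] {n : ℕ}

/-- A hypersurface all of whose irreducible components contain a preperiodic point is dynamically
improper. -/
theorem isDynamicallyImproper_of_preperiodic {f : ProjSpace K n → ProjSpace K n}
    {H : Set (ProjSpace K n)}
    (h : ∀ Z, IsIrreducibleComponentOf Z H → ∃ x ∈ Z, ∃ i j, i < j ∧ f^[i] x = f^[j] x) :
    IsDynamicallyImproper f H := by
  intro r hr Z hZ
  obtain ⟨x, hx, i, j, hij, hfx⟩ := h Z hZ
  exact exists_strictMono_iterates_nonempty hx hij hfx hr (n + 1)

/-- Iterates of an endomorphism of projective space, computed on representatives. -/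
theorem iterate_mk {f : ProjSpace K n → ProjSpace K n} {E : (Fin (n + 1) → K) → Fin (n + 1) → K}
    (hE : ∀ (v : Fin (n + 1) → K) (hv : v ≠ 0), ∃ hEv : E v ≠ 0,
      f (Projectivization.mk K v hv) = Projectivization.mk K (E v) hEv)
    (v : Fin (n + 1) → K) (hv : v ≠ 0) (k : ℕ) :
    ∃ hk : E^[k] v ≠ 0,
      f^[k] (Projectivization.mk K v hv) = Projectivization.mk K (E^[k] v) hk := by
  induction k with
  | zero => exact ⟨hv, rfl⟩
  | succ k ih =>
    obtain ⟨hk, hfk⟩ := ih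
    obtain ⟨hk', h⟩ := hE _ hk
    simp only [Function.iterate_succ_apply']
    exact ⟨hk', by rw [hfk, h]⟩

/-- A nonlinear endomorphism has preperiodic points in infinitely many hyperplanes of the pencil
spanned by two coordinate hyperplanes. -/
theorem infinite_preperiodic [IsAlgClosed K] {d : ℕ} (hd : 2 ≤ d)
    {f : ProjSpace K n → ProjSpace K n} (hf : IsEndomorphism d f) {k l : Fin (n + 1)}
    (hkl : k ≠ l) :
    {s : K | ∃ (v : Fin (n + 1) → K) (hv : v ≠ 0), v k = 1 ∧ v l = s ∧ ∃ i j, i < j ∧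
      f^[i] (Projectivization.mk K v hv) = f^[j] (Projectivization.mk K v hv)}.Infinite := by
  obtain ⟨F, hFd, hF⟩ := hf
  refine (infinite_ratio_preperiodic hd hFd (fun v hv => ?_) hkl).mono ?_
  · obtain ⟨h, -⟩ := hF v hv
    exact Function.ne_iff.1 h
  · rintro s ⟨a, hak, hal, i, j, hij, h⟩
    have ha : a ≠ 0 := fun h0 => hak (by rw [h0, Pi.zero_apply])
    have hv : (a k)⁻¹ • a ≠ 0 := smul_ne_zero (inv_ne_zero hak) ha
    refine ⟨(a k)⁻¹ • a, hv, by simp [hak], by simp [hal, hak, mul_comm], i, j, hij, ?_⟩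
    have hmk : Projectivization.mk K ((a k)⁻¹ • a) hv = Projectivization.mk K a ha :=
      (Projectivization.mk_eq_mk_iff' K _ _ _ _).2 ⟨(a k)⁻¹, rfl⟩
    obtain ⟨hi, hi'⟩ := iterate_mk (E := fun w i => eval w (F i)) hF a ha i
    obtain ⟨hj, hj'⟩ := iterate_mk (E := fun w i => eval w (F i)) hF a ha j
    rw [hmk, hi', hj']
    simp only [h]

/-- Zero-dimensional projective space is a point. -/
theorem subsingleton_projSpace_zero : Subsingleton (ProjSpace K 0) := by
  refine ⟨fun x y => ?_⟩
  have hi : ∀ i : Fin (0 + 1), i = 0 := by decide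
  rw [← x.mk_rep, ← y.mk_rep, Projectivization.mk_eq_mk_iff']
  have hy : y.rep 0 ≠ 0 := fun h => y.rep_nonzero (funext fun i => by
    rw [hi i, h, Pi.zero_apply])
  refine ⟨x.rep 0 / y.rep 0, funext fun i => ?_⟩
  rw [hi i, Pi.smul_apply, smul_eq_mul, div_mul_cancel₀ _ hy]

end Dynamics

/-! ### Density in the space of forms -/

section Density

variable {K : Type*} [Field K] {n m : ℕ}

/-- A set of forms is dense if it meets the complement of every hypersurface that does not contain
all forms. -/
theorem dense_of_forall_eval_ne_zero {V : Type*} [AddCommGroup V] [Module K V] {s : Set (ℙ K V)}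
    (h : ∀ (p : MvPolynomial (Module.Dual K V) K) (k : ℕ), p.IsHomogeneous k →
      (∃ v : V, v ≠ 0 ∧ eval (fun φ : Module.Dual K V => φ v) p ≠ 0) →
      ∃ (v : V) (hv : v ≠ 0), Projectivization.mk K v hv ∈ s ∧
        eval (fun φ : Module.Dual K V => φ v) p ≠ 0) : Dense s := by
  rw [dense_iff_inter_open]
  rintro U hU ⟨x, hx⟩
  obtain ⟨S, hS, hUS⟩ := isClosed_iff_isZariskiClosed.1 hU.isClosed_compl
  have hx' : x ∉ projZeroLocus S := by
    rw [← hUS]; exact fun h => h hx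
  simp only [projZeroLocus, Set.mem_ofPred_eq, not_forall] at hx'
  obtain ⟨p, hp, hpx⟩ := hx'
  obtain ⟨k, hk⟩ := hS p hp
  obtain ⟨v, hv, hvs, hpv⟩ := h p k hk ⟨x.rep, x.rep_nonzero, hpx⟩
  refine ⟨Projectivization.mk K v hv, ?_, hvs⟩
  by_contra hU'
  have hmem : Projectivization.mk K v hv ∈ projZeroLocus S := by
    rw [← hUS]; exact hU'
  obtain ⟨c, hc⟩ := Projectivization.exists_smul_eq_mk_rep K v hv
  have h0 := hmem p hp
  rw [← hc, Units.smul_def] at h0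
  have e : (fun φ : Module.Dual K V => φ ((c : K) • v)) = (c : K) • fun φ => φ v := by
    funext φ; simp
  rw [e, eval_smul_of_isHomogeneous hk] at h0
  exact (mul_ne_zero (pow_ne_zero _ c.ne_zero) hpv) h0

theorem vanishingLocus_mk (A : MvPolynomial.homogeneousSubmodule (Fin (n + 1)) K m) (hA : A ≠ 0) :
    vanishingLocus (Projectivization.mk K A hA) = formLocus (A : MvPolynomial (Fin (n + 1)) K) := by
  obtain ⟨c, hc⟩ := Projectivization.exists_smul_eq_mk_rep K A hA
  ext x
  simp only [vanishingLocus, formLocus, Set.mem_ofPred_eq]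
  rw [← hc, Units.smul_def, Submodule.coe_smul, smul_eval]
  simp

/-- Given infinitely many points with distinct ratios of two coordinates, the forms that are
products of irreducible forms vanishing at one of these points are dense. -/
theorem dense_irreducible_factors_through_points (hm : 1 ≤ m) {k l : Fin (n + 1)} {S : Set K}
    (hS : S.Infinite) {pt : K → Fin (n + 1) → K} (hk : ∀ s ∈ S, pt s k = 1)
    (hl : ∀ s ∈ S, pt s l = s) :
    Dense {Φ : FormSpace K n m | ∃ (r : ℕ) (e : Fin r → ℕ)
      (A : Fin r → MvPolynomial (Fin (n + 1)) K), (∀ i, (A i).IsHomogeneous (e i)) ∧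
      (∀ i, Irreducible (A i)) ∧ (∀ i, ∃ s ∈ S, eval (pt s) (A i) = 0) ∧
      vanishingLocus Φ = formLocus (∏ i, A i)} := by
  refine dense_of_forall_eval_ne_zero fun p j hp ⟨Φ, hΦ0, hpΦ⟩ => ?_
  obtain ⟨ℓ, hℓ⟩ : ∃ ℓ : Module.Dual K (homogeneousSubmodule (Fin (n + 1)) K m), ℓ Φ ≠ 0 := by
    by_contra! hcon
    exact hΦ0 ((Module.forall_dual_apply_eq_zero_iff K Φ).1 hcon)
  let π : MvPolynomial (Fin (n + 1)) K →ₗ[K] homogeneousSubmodule (Fin (n + 1)) K m :=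
    (homogeneousComponent m).codRestrict _ fun P => homogeneousComponent_mem m P
  have hπ : ∀ (P : MvPolynomial (Fin (n + 1)) K) (hP : P.IsHomogeneous m), π P = ⟨P, hP⟩ :=
    fun P hP => Subtype.ext (homogeneousComponent_eq_self hP)
  -- `π` extends `p` to all polynomials; the factor `X ℓ` ensures `g 0 = 0` even when `p` is
  -- constant.
  let g : MvPolynomial (Fin (n + 1)) K → K := fun P => eval (fun φ => φ (π P)) (p * X ℓ)
  have hg0 : g 0 = 0 := by simp [g]
  have hg : ∀ P Q, ∃ q : Polynomial K, ∀ t, q.eval t = g (P + C t * Q) := fun P Q => by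
    refine ⟨eval₂ Polynomial.C
      (fun φ => Polynomial.C (φ (π P)) + Polynomial.X * Polynomial.C (φ (π Q))) (p * X ℓ),
      fun t => ?_⟩
    have := eval₂_comp_left (Polynomial.evalRingHom t) Polynomial.C
      (fun φ => Polynomial.C (φ (π P)) + Polynomial.X * Polynomial.C (φ (π Q))) (p * X ℓ)
    rw [Polynomial.coe_evalRingHom] at this
    rw [this]
    have e1 : (Polynomial.evalRingHom t).comp Polynomial.C = RingHom.id K := by
      ext c; simp
    have e2 : (Polynomial.eval t ∘ fun φ : Module.Dual K (homogeneousSubmodule (Fin (n + 1)) K m) =>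
        Polynomial.C (φ (π P)) + Polynomial.X * Polynomial.C (φ (π Q))) =
        fun φ => φ (π (P + C t * Q)) := by
      funext φ
      simp only [Function.comp_apply, ← smul_eq_C_mul, Polynomial.eval_add, Polynomial.eval_mul,
        Polynomial.eval_C, Polynomial.eval_X, map_add, map_smul, smul_eq_mul]
    rw [e1, e2]
    rfl
  have hgΦ : g Φ ≠ 0 := by
    have e : π (Φ : MvPolynomial (Fin (n + 1)) K) = Φ := hπ _ Φ.2
    simp only [g, e, map_mul, eval_X]
    exact mul_ne_zero hpΦ hℓ
  obtain ⟨r, e, A, hA, hsum, hirr, hpt, hgA⟩ :=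
    exists_irreducible_factors_through_points hg0 hg hS hk hl hm Φ.2 hgΦ
  have hprod : (∏ i, A i).IsHomogeneous m := hsum ▸ IsHomogeneous.prod _ _ _ fun i _ => hA i
  have hne : (⟨∏ i, A i, hprod⟩ : homogeneousSubmodule (Fin (n + 1)) K m) ≠ 0 := fun h0 => by
    apply hgA
    rw [show ∏ i, A i = 0 from congrArg Subtype.val h0, hg0]
  refine ⟨⟨∏ i, A i, hprod⟩, hne, ⟨r, e, A, hA, hirr, hpt, vanishingLocus_mk _ hne⟩, ?_⟩
  simp only [g, hπ _ hprod, map_mul] at hgA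
  exact left_ne_zero_of_mul hgA

end Density

end DynImproper

theorem theorem1 {K : Type*} [Field K] [IsAlgClosed K] [CharZero K] (n m d : ℕ)
    (hm : 1 ≤ m) (hd : 2 ≤ d)
    (f : DynImproper.ProjSpace K n → DynImproper.ProjSpace K n)
    (hf : DynImproper.IsEndomorphism d f) :
    Dense {Φ : DynImproper.FormSpace K n m |
      DynImproper.IsDynamicallyImproper f (DynImproper.vanishingLocus Φ)} := by
  -- For `n = 0` there are no two distinct coordinates, but the space is a single, fixed point.
  rcases Nat.eq_zero_or_pos n with rfl | hn
  · have hsub : Subsingleton (DynImproper.ProjSpace K 0) := DynImproper.subsingleton_projSpace_zero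
    have huniv : {Φ : DynImproper.FormSpace K 0 m |
        DynImproper.IsDynamicallyImproper f (DynImproper.vanishingLocus Φ)} = Set.univ :=
      Set.eq_univ_of_forall fun Φ => DynImproper.isDynamicallyImproper_of_preperiodic fun Z hZ => by
        obtain ⟨x, hx⟩ := hZ.1.1.1
        exact ⟨x, hx, 0, 1, Nat.zero_lt_one, Subsingleton.elim _ _⟩
    rw [huniv]
    exact dense_univ
  · have hkl : (0 : Fin (n + 1)) ≠ Fin.last n := by
      rw [Ne, Fin.ext_iff]
      simpa using hn.ne
    have hS := DynImproper.infinite_preperiodic hd hf hkl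
    choose! pt hpt0 hptk hptl i j hij hper using
      fun s (hs : s ∈ {s : K | ∃ (v : Fin (n + 1) → K) (hv : v ≠ 0), v 0 = 1 ∧ v (Fin.last n) = s ∧
        ∃ i j, i < j ∧ f^[i] (Projectivization.mk K v hv) = f^[j] (Projectivization.mk K v hv)}) =>
        hs
    refine (DynImproper.dense_irreducible_factors_through_points hm hS hptk hptl).mono ?_
    rintro Φ ⟨r, e, A, hA, hirr, hzero, hΦ⟩
    have hmem : ∀ i, ∃ x ∈ DynImproper.formLocus (A i), ∃ i j, i < j ∧ f^[i] x = f^[j] x :=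
      fun a => by
        obtain ⟨s, hs, h0⟩ := hzero a
        exact ⟨_, DynImproper.mk_mem_formLocus (hA a) (hpt0 s hs) h0, i s, j s, hij s hs, hper s hs⟩
    refine DynImproper.isDynamicallyImproper_of_preperiodic fun Z hZ => ?_
    rw [hΦ] at hZ
    obtain ⟨a, rfl⟩ := DynImproper.exists_eq_formLocus_of_isIrreducibleComponentOf hA hirr
      (fun a => (hmem a).imp fun x hx => hx.1) hZ
    exact hmem a
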